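/- Let $F$ be a finite field with $q$ elements, $u$ a generator of $F^\times$, $\zeta=e^{2\pi i/(q-1)}$, $k\in\mathbb Z$, and let $L(x)\in\{0,\dots,q-2\}$ denote the discrete logarithm of $x\in F^\times$, so $x=u^{L(x)}$. Let $T_k$ be the unitary operator on $L^2(F)$ with $T_k|0\rangle=|0\rangle$ and $T_k|x\rangle=\zeta^{-kL(x)}|x\rangle$ for $x\ne0$. Given a unit vector $v=\sum_{x\in F^\times}a_x|x\rangle$, one run of the algorithm is the following. Prepare $$\frac1{q-1}\sum_{r,s=0}^{q-2}\sum_{x\neq0}a_x|r\rangle|x\rangle|s\rangle|0\rangle ;$$ apply $V|r\rangle|x\rangle|s\rangle|z\rangle=|r\rangle|x\rangle|s\rangle|z+x^ru^s\rangle$; apply $\mathcal F_M\otimes I\otimes\mathcal F_M\otimes I$, where $\mathcal F_M|r\rangle=\frac1{\sqrt{q-1}}\sum_{l=0}^{q-2}\zeta^{lr}|l\rangle$; measure and discard the third and fourth registers, obtaining $m\in\mathbb Z/(q-1)\mathbb Z$ and an element of $F$. If $\gcd(m,q-1)\ne1$, report failure. Otherwise apply successively $|l\rangle|x\rangle\mapsto|m^{-1}l\rangle|x\rangle$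 (inverse modulo $q-1$), $|j\rangle|x\rangle\mapsto\zeta^{-kj}|j\rangle|x\rangle$ and $|j\rangle|x\rangle\mapsto|u^j\rangle|u^{-j}x\rangle$, and discard the last register. A run succeeds if it ends, before the last register is discarded, in the state $T_kv\otimes|1\rangle$ up to a global phase. (1) For every $q$: the outcome weights given by Born's rule sum to $1$; every run in which an outcome of positive probability with $\gcd(m,q-1)=1$ is measured succeeds; and a run succeeds with probability exactly $\varphi(q-1)/(q-1)$, where $\varphi$ is Euler's function. (2) There is an absolute constant $Q_0$ such that for all $q\ge Q_0$, all $F,u,k,v$ as above, all $0<\varepsilon<1$ and every integer $N\ge-2\log\log(q-1)\log\varepsilon$ ($\log$ is the natural logarithm): if the algorithm is run $N$ times independently, each time on a fresh copy of $v$, then with probability at least $1-\varepsilon$ some run does not report failure and the first such run succeeds, i.e. produces $T_kv$. -/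

import Mathlib

universe w

noncomputable section

namespace TkAlgorithm

instance neZero_card_sub_one (F : Type*) [Field F] [Fintype F] :
    NeZero (Fintype.card F - 1) :=
  ⟨Nat.sub_ne_zero_of_lt Fintype.one_lt_card⟩

/-- A vector of the Hilbert space `L²(ι)` of a finite set `ι`, given by its amplitudes in the
computational basis `|i⟩`, `i ∈ ι`. Its norm is the one given by `normSq` (not the sup norm). -/
abbrev Ket (ι : Type*) := ι → ℂ

/-- The squared Hilbert space norm. -/
def normSq {ι : Type*} [Fintype ι] (ψ : Ket ι) : ℝ := ∑ i, ‖ψ i‖ ^ 2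

open Classical in
/-- The linear map sending every basis vector `|i⟩` to the basis vector `|f i⟩`. -/
def basisMap {ι κ : Type*} [Fintype ι] (f : ι → κ) (ψ : Ket ι) : Ket κ :=
  fun y => ∑ i, if f i = y then ψ i else 0

/-- The index set `ℤ/(q-1)`, `q = |F|`, of a register of dimension `q - 1`. -/
abbrev Idx (F : Type*) [Fintype F] := ZMod (Fintype.card F - 1)

/-- `ζ = exp (2πi / (q-1))`. -/
def zeta (F : Type*) [Fintype F] : ℂ :=
  Complex.exp (2 * Real.pi * Complex.I / ((Fintype.card F - 1 : ℕ) : ℂ))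

/-- The discrete logarithm: the least `j` with `u ^ j = x`. If `u` generates `Fˣ` and `x ≠ 0`, it
exists and satisfies `0 ≤ j ≤ q - 2`. -/
def discreteLog {F : Type*} [Field F] (u : Fˣ) (x : F) : ℕ :=
  sInf {j : ℕ | (u : F) ^ j = x}

open Classical in
/-- The diagonal unitary `T_k` on `L²(F)`: `T_k |0⟩ = |0⟩` and
`T_k |u ^ j⟩ = ζ ^ (-jk) |u ^ j⟩`. -/
def Tk {F : Type*} [Field F] [Fintype F] (u : Fˣ) (k : ℤ) (v : Ket F) : Ket F :=
  fun x => if x = 0 then v x else zeta F ^ (-((discreteLog u x : ℤ) * k)) * v x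

open Classical in
/-- The initial state `1/(q-1) ∑_{r,s} ∑_x a_x |r⟩ ⊗ |x⟩ ⊗ |s⟩ ⊗ |0⟩`, where `v = ∑_x a_x |x⟩`. -/
def initialState {F : Type*} [Field F] [Fintype F] (v : Ket F) :
    Ket (Idx F × F × Idx F × F) :=
  fun ⟨_, x, _, z⟩ => if z = 0 then v x / ((Fintype.card F - 1 : ℕ) : ℂ) else 0

/-- The unitary `V |r⟩|x⟩|s⟩|z⟩ = |r⟩|x⟩|s⟩|z + x ^ r u ^ s⟩`, with `0 ≤ r, s ≤ q - 2`. -/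
def opV {F : Type*} [Field F] [Fintype F] (u : Fˣ) :
    Ket (Idx F × F × Idx F × F) → Ket (Idx F × F × Idx F × F) :=
  basisMap fun ⟨r, x, s, z⟩ => (r, x, s, z + x ^ r.val * (u : F) ^ s.val)

/-- The matrix entries `⟨l| 𝓕_M |r⟩ = ζ ^ (lr) / √(q-1)` of the multiplicative quantum Fourier
transform, `|r⟩` standing for `|u ^ r⟩`. -/
def qftEntry (F : Type*) [Field F] [Fintype F] (l r : Idx F) : ℂ :=
  zeta F ^ (l.val * r.val) / (Real.sqrt ((Fintype.card F - 1 : ℕ) : ℝ) : ℂ)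

/-- The operator `𝓕_M ⊗ I ⊗ 𝓕_M ⊗ I`. -/
def opQFT {F : Type*} [Field F] [Fintype F] (ψ : Ket (Idx F × F × Idx F × F)) :
    Ket (Idx F × F × Idx F × F) :=
  fun ⟨l, x, m, z⟩ => ∑ r, ∑ s, qftEntry F l r * qftEntry F m s * ψ (r, x, s, z)

/-- The state just before the measurement. -/
def preMeasure {F : Type*} [Field F] [Fintype F] (u : Fˣ) (v : Ket F) :
    Ket (Idx F × F × Idx F × F) :=
  opQFT (opV u (initialState v))

/-- The unnormalized projection of the state onto the measurement outcome `o = (m, z)` of the third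
and fourth registers, with these registers discarded. -/
def projected {F : Type*} [Field F] [Fintype F] (u : Fˣ) (v : Ket F) (o : Idx F × F) :
    Ket (Idx F × F) :=
  fun ⟨l, x⟩ => preMeasure u v (l, x, o.1, o.2)

/-- The probability (Born's rule) of the outcome `o = (m, z)` when the third and fourth registers are
measured. -/
def outcomeProb {F : Type*} [Field F] [Fintype F] (u : Fˣ) (v : Ket F) (o : Idx F × F) : ℝ :=
  normSq (projected u v o)

/-- The normalized state to which the first two registers collapse when `o` is measured. -/
def collapsed {F : Type*} [Field F] [Fintype F] (u : Fˣ) (v : Ket F) (o : Idx F × F) :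
    Ket (Idx F × F) :=
  fun i => projected u v o i / (Real.sqrt (outcomeProb u v o) : ℂ)

/-- `|l⟩|x⟩ ↦ |m⁻¹ l⟩|x⟩`, with the inverse in `ℤ/(q-1)`. -/
def opInv {F : Type*} [Field F] [Fintype F] (m : Idx F) :
    Ket (Idx F × F) → Ket (Idx F × F) :=
  basisMap fun ⟨l, x⟩ => (m⁻¹ * l, x)

/-- `U_k |j⟩|x⟩ = ζ ^ (-kj) |j⟩|x⟩`. -/
def opU {F : Type*} [Field F] [Fintype F] (k : ℤ) (ψ : Ket (Idx F × F)) : Ket (Idx F × F) :=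
  fun ⟨j, x⟩ => zeta F ^ (-(k * (j.val : ℤ))) * ψ (j, x)

/-- `T |j⟩|x⟩ = |u ^ j⟩|u ^ (-j) x⟩`, from `L²(ℤ/(q-1) × F)` to `L²(Fˣ × F)`. -/
def opT {F : Type*} [Field F] [Fintype F] (u : Fˣ) :
    Ket (Idx F × F) → Ket (Fˣ × F) :=
  basisMap fun ⟨j, x⟩ => (u ^ j.val, ((u ^ j.val)⁻¹ : Fˣ) * x)

/-- The final state of one run of the algorithm in which `o = (m, z)` has been measured. If `m` is
not prime to `q - 1`, the run reports failure and has no final state. -/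
def runOutput {F : Type*} [Field F] [Fintype F] (u : Fˣ) (k : ℤ) (v : Ket F) (o : Idx F × F) :
    Option (Ket (Fˣ × F)) :=
  if Nat.Coprime o.1.val (Fintype.card F - 1) then
    some (opT u (opU k (opInv o.1 (collapsed u v o))))
  else none

open Classical in
/-- The final state `Ψ` is `T_k v ⊗ |1⟩` up to a global phase, so that discarding the second factor
leaves the state `T_k v` (here `v`, hence `T_k v`, has no component along `|0⟩`). -/
def IsTkState {F : Type*} [Field F] [Fintype F] (u : Fˣ) (k : ℤ) (v : Ket F)
    (Ψ : Ket (Fˣ × F)) : Prop :=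
  ∃ c : ℂ, ‖c‖ = 1 ∧
    ∀ (y : Fˣ) (z : F), Ψ (y, z) = c * (Tk u k v (y : F) * if z = 1 then 1 else 0)

/-- A single run with measurement outcome `o` produces `T_k v`. -/
def RunSucceeds {F : Type*} [Field F] [Fintype F] (u : Fˣ) (k : ℤ) (v : Ket F)
    (o : Idx F × F) : Prop :=
  ∃ Ψ, runOutput u k v o = some Ψ ∧ IsTkState u k v Ψ

/-- The algorithm is run `N` times, each time on a fresh copy of `v`, with measurement outcomes
`ω 0, …, ω (N-1)`: the first run that does not report failure exists and produces `T_k v`. -/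
def RepeatSucceeds {F : Type*} [Field F] [Fintype F] (u : Fˣ) (k : ℤ) (v : Ket F) {N : ℕ}
    (ω : Fin N → Idx F × F) : Prop :=
  ∃ i, RunSucceeds u k v (ω i) ∧ ∀ j < i, runOutput u k v (ω j) = none

open Classical in
/-- The probability that a single run produces `T_k v`. -/
def runSuccessProb {F : Type*} [Field F] [Fintype F] (u : Fˣ) (k : ℤ) (v : Ket F) : ℝ :=
  ∑ o : Idx F × F, if RunSucceeds u k v o then outcomeProb u v o else 0

open Classical in
/-- The probability that `N` independent runs produce `T_k v`. -/
def repeatSuccessProb {F : Type*} [Field F] [Fintype F] (u : Fˣ) (k : ℤ) (v : Ket F)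
    (N : ℕ) : ℝ :=
  ∑ ω : Fin N → Idx F × F,
    if RepeatSucceeds u k v ω then ∏ i, outcomeProb u v (ω i) else 0

end TkAlgorithm

end

/-! Write `x = u ^ a` and `z = u ^ t`. The operator `V` puts `z = x ^ r u ^ s` in the last register
exactly when `s = t - a r` modulo `q - 1`. After the Fourier transforms the sum over `r` is a full
character sum, which forces `l = m a`; what remains is the phase of `m t` times `∑ a_x |m L(x)⟩|x⟩`,
with the same weight `1/(q-1)^2` for all `m` and all `z ≠ 0`, while `z = 0` never occurs. Hence `m`
is uniform modulo `q - 1` and is invertible with probability `φ(q-1)/(q-1)`. For invertible `m` the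
register `m L(x)` becomes `L(x)`, the phase `ζ ^ (-k L(x))` can be applied, and the last map turns
`|L(x)⟩|x⟩` into `|x⟩|1⟩`.

With `p = φ(q-1)/(q-1)`, all `N` runs fail with probability `(1 - p)^N ≤ exp (-p N)`, so the second
claim reduces to `φ(n)/n ≥ 1 / (2 log log n)` for large `n`. This follows from the upper bound in
Mertens' third theorem with its exact constant, because `exp (-γ) > 1/2`. Mertens' theorem is proved
for sums of `Λ` by partial summation, and the constant is identified by comparing a Laplace
transform with `log ζ(1 + δ)` as `δ → 0`. -/

namespace Mertens

open Filter Topology MeasureTheory Finset ArithmeticFunction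

/-! ### Mertens' first theorem for the von Mangoldt function -/

/-- The summatory function of `Λ n / n`. -/
noncomputable def sumVonMangoldtDiv (x : ℝ) : ℝ := ∑ n ∈ Icc 0 ⌊x⌋₊, Λ n / n

/-- The summatory function of `Λ n / (n log n)`. -/
noncomputable def sumVonMangoldtDivLog (x : ℝ) : ℝ :=
  ∑ n ∈ Icc 0 ⌊x⌋₊, (Real.log n)⁻¹ * (Λ n / n)

theorem log_factorial_eq_sum_log (n : ℕ) :
    Real.log (n.factorial : ℝ) = ∑ m ∈ Ioc 0 n, Real.log m := by
  induction n with
  | zero => simp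
  | succ n ih =>
    rw [Nat.factorial_succ, Nat.cast_mul, Real.log_mul (by positivity) (by positivity), ih,
      Finset.sum_Ioc_succ_top (Nat.zero_le n), add_comm]

theorem log_factorial_eq_sum_vonMangoldt (n : ℕ) :
    Real.log (n.factorial : ℝ) = ∑ d ∈ Ioc 0 n, Λ d * ((n / d : ℕ) : ℝ) := by
  rw [log_factorial_eq_sum_log, ← sum_Ioc_mul_zeta_eq_sum, vonMangoldt_mul_zeta]
  rfl

theorem sumVonMangoldtDiv_natCast (n : ℕ) :
    sumVonMangoldtDiv n = ∑ d ∈ Ioc 0 n, Λ d / d := by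
  rw [sumVonMangoldtDiv, Nat.floor_natCast, ← add_sum_Ioc_eq_sum_Icc (Nat.zero_le n)]
  simp

/-- Dropping the floors in `log n! = ∑ Λ d ⌊n/d⌋` only increases the sum, and Stirling bounds `log
n!` below by `n log n - n`. -/
theorem log_sub_one_le_sumVonMangoldtDiv {n : ℕ} (hn : n ≠ 0) :
    Real.log n - 1 ≤ sumVonMangoldtDiv n := by
  have hn' : (0 : ℝ) < n := by positivity
  have h1 : Real.log (n.factorial : ℝ) ≤ n * sumVonMangoldtDiv n := by
    rw [log_factorial_eq_sum_vonMangoldt, sumVonMangoldtDiv_natCast, mul_sum]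
    refine sum_le_sum fun d _ => ?_
    calc Λ d * ((n / d : ℕ) : ℝ) ≤ Λ d * (n / d) :=
          mul_le_mul_of_nonneg_left Nat.cast_div_le vonMangoldt_nonneg
      _ = n * (Λ d / d) := by ring
  have h2 := Stirling.le_log_factorial_stirling hn
  have h3 : 0 ≤ Real.log n := Real.log_natCast_nonneg n
  have h4 : 0 ≤ Real.log (2 * Real.pi) := Real.log_nonneg (by linarith [Real.pi_gt_three])
  refine le_of_mul_le_mul_left ?_ hn'
  linarith

/-- Removing the floors costs at most `Λ d` for each `d`, in total `ψ(n)`, which Chebyshev's bound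
makes at most `(log 4 + 4) n`; moreover `n! ≤ n ^ n`. -/
theorem sumVonMangoldtDiv_le {n : ℕ} (hn : n ≠ 0) :
    sumVonMangoldtDiv n ≤ Real.log n + (Real.log 4 + 4) := by
  have hn' : (0 : ℝ) < n := by positivity
  have h1 : n * sumVonMangoldtDiv n - Chebyshev.psi n ≤ Real.log (n.factorial : ℝ) := by
    rw [log_factorial_eq_sum_vonMangoldt, sumVonMangoldtDiv_natCast, mul_sum, Chebyshev.psi,
      Nat.floor_natCast, ← sum_sub_distrib]
    refine sum_le_sum fun d hd => ?_
    have hd0 : 0 < d := (mem_Ioc.1 hd).1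
    have : (n : ℝ) / d < (n / d : ℕ) + 1 := by
      rw [div_lt_iff₀ (by positivity)]
      rw [mul_comm]
      exact_mod_cast Nat.lt_mul_div_succ n hd0
    have h0 : 0 ≤ Λ d := vonMangoldt_nonneg
    calc (n : ℝ) * (Λ d / d) - Λ d = Λ d * (n / d - 1) := by ring
      _ ≤ _ := mul_le_mul_of_nonneg_left (by linarith) h0
  have h2 : Real.log (n.factorial : ℝ) ≤ n * Real.log n := by
    rw [← Real.log_pow]
    exact Real.log_le_log (by positivity) (mod_cast Nat.factorial_le_pow n)
  have h3 := Chebyshev.psi_le_const_mul_self hn'.le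
  refine le_of_mul_le_mul_left ?_ hn'
  linarith

/-- Mertens' first theorem for the von Mangoldt function. -/
theorem exists_abs_sumVonMangoldtDiv_sub_log_le :
    ∃ M, ∀ x : ℝ, 1 ≤ x → |sumVonMangoldtDiv x - Real.log x| ≤ M := by
  refine ⟨Real.log 4 + 4, fun x hx => ?_⟩
  have hf : ⌊x⌋₊ ≠ 0 := (Nat.floor_pos.2 hx).ne'
  have hf1 : (1 : ℝ) ≤ (⌊x⌋₊ : ℝ) := by exact_mod_cast Nat.floor_pos.2 hx
  have h1 := log_sub_one_le_sumVonMangoldtDiv hf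
  have h2 := sumVonMangoldtDiv_le hf
  have h0 : sumVonMangoldtDiv (⌊x⌋₊ : ℝ) = sumVonMangoldtDiv x := by
    simp [sumVonMangoldtDiv]
  rw [h0] at h1 h2
  have h3 : Real.log ⌊x⌋₊ ≤ Real.log x :=
    Real.log_le_log (by linarith) (Nat.floor_le (by linarith))
  -- The crude `x ≤ 4 ⌊x⌋` suffices, since the constant `log 4 + 4` already contains `log 4`.
  have h4 : Real.log x ≤ Real.log ⌊x⌋₊ + Real.log 4 := by
    rw [← Real.log_mul (by linarith) (by norm_num)]
    exact Real.log_le_log (by linarith) (by linarith [Nat.lt_floor_add_one x])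
  rw [abs_le]
  constructor <;> linarith

/-! ### Partial summation: Mertens' second theorem with an unspecified constant -/

theorem hasDerivAt_inv_log {t : ℝ} (ht : 1 < t) :
    HasDerivAt (fun t => (Real.log t)⁻¹) (-(1 / (t * Real.log t ^ 2))) t := by
  have h0 : Real.log t ≠ 0 := (Real.log_pos ht).ne'
  have h1 : t ≠ 0 := by linarith
  exact ((Real.hasDerivAt_log h1).fun_inv h0).congr_deriv (by field_simp)

theorem hasDerivAt_log_log {t : ℝ} (ht : 1 < t) :
    HasDerivAt (fun t => Real.log (Real.log t)) (1 / (t * Real.log t)) t := by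
  have h0 : Real.log t ≠ 0 := (Real.log_pos ht).ne'
  have h1 : t ≠ 0 := by linarith
  exact ((Real.hasDerivAt_log h1).log h0).congr_deriv (by field_simp)

theorem integrableOn_one_div_mul_log_sq :
    IntegrableOn (fun t : ℝ => 1 / (t * Real.log t ^ 2)) (Set.Ioi 2) := by
  have := integrableOn_Ioi_deriv_of_nonpos' (a := 2) (l := 0)
    (g := fun t => (Real.log t)⁻¹) (g' := fun t => -(1 / (t * Real.log t ^ 2)))
    (fun t ht => hasDerivAt_inv_log (by have : (2 : ℝ) ≤ t := ht; linarith))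
    (fun t ht => by
      have : (2 : ℝ) < t := ht
      have : 0 ≤ t := by linarith
      simp only [Left.neg_nonpos_iff]
      positivity)
    (tendsto_inv_atTop_zero.comp Real.tendsto_log_atTop)
  simpa using this.neg

theorem continuousOn_one_div_mul_log_pow (k : ℕ) :
    ContinuousOn (fun t : ℝ => 1 / (t * Real.log t ^ k)) (Set.Ici 2) := by
  intro t ht
  have ht : (2 : ℝ) ≤ t := ht
  have h0 : t ≠ 0 := by linarith
  have h1 : t * Real.log t ^ k ≠ 0 :=
    mul_ne_zero h0 (pow_ne_zero _ (Real.log_pos (by linarith)).ne')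
  exact ContinuousAt.continuousWithinAt (by fun_prop (disch := assumption))

theorem measurable_sumVonMangoldtDiv : Measurable sumVonMangoldtDiv :=
  (measurable_from_nat (f := fun m => ∑ n ∈ Icc 0 m, Λ n / (n : ℝ))).comp Nat.measurable_floor

theorem integrableOn_remainder :
    IntegrableOn (fun t : ℝ => (sumVonMangoldtDiv t - Real.log t) * (1 / (t * Real.log t ^ 2)))
      (Set.Ioi 2) := by
  obtain ⟨M, hM⟩ := exists_abs_sumVonMangoldtDiv_sub_log_le
  refine Integrable.bdd_mul (c := M) integrableOn_one_div_mul_log_sq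
    (measurable_sumVonMangoldtDiv.sub Real.measurable_log).aestronglyMeasurable ?_
  filter_upwards [ae_restrict_mem measurableSet_Ioi] with t ht
  exact hM t (by have : (2 : ℝ) < t := ht; linarith)

/-- Abel summation against `1 / log t`, with the partial sums of `Λ n / n` split as `log t` plus a
bounded remainder. The main part yields `1` and `log log x - log log 2`; the remainder integral
converges absolutely. -/
theorem sumVonMangoldtDivLog_eq {x : ℝ} (hx : 2 ≤ x) :
    sumVonMangoldtDivLog x - Real.log (Real.log x) =
      (sumVonMangoldtDiv x - Real.log x) * (Real.log x)⁻¹ + (1 - Real.log (Real.log 2)) +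
      ∫ t in (2 : ℝ)..x, (sumVonMangoldtDiv t - Real.log t) * (1 / (t * Real.log t ^ 2)) := by
  have hlx : Real.log x ≠ 0 := (Real.log_pos (by linarith)).ne'
  have hd : ∀ t ∈ Set.Icc 2 x, HasDerivAt (fun t => (Real.log t)⁻¹)
      (-(1 / (t * Real.log t ^ 2))) t := fun t ht => hasDerivAt_inv_log (by linarith [ht.1])
  have hcont : ContinuousOn (fun t : ℝ => -(1 / (t * Real.log t ^ 2))) (Set.Icc 2 x) :=
    ((continuousOn_one_div_mul_log_pow 2).mono Set.Icc_subset_Ici_self).neg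
  have hint : IntegrableOn (deriv fun t => (Real.log t)⁻¹) (Set.Icc 2 x) :=
    hcont.integrableOn_Icc.congr_fun (fun t ht => (hd t ht).deriv.symm) measurableSet_Icc
  -- The coefficients at `0` and `1` vanish, so the integral starts at `2`, away from the zero of
  -- `log` at `1`.
  have habel := sum_mul_eq_sub_integral_mul₁ (f := fun t : ℝ => (Real.log t)⁻¹)
    (fun n : ℕ => Λ n / (n : ℝ)) (by simp) (by simp) x
    (fun t ht => (hd t ht).differentiableAt) hint
  have hI1 : IntervalIntegrable (fun t : ℝ => 1 / (t * Real.log t)) volume 2 x := by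
    apply ContinuousOn.intervalIntegrable
    rw [Set.uIcc_of_le hx]
    simpa using (continuousOn_one_div_mul_log_pow 1).mono Set.Icc_subset_Ici_self
  have hI2 : IntervalIntegrable (fun t : ℝ => (sumVonMangoldtDiv t - Real.log t) *
      (1 / (t * Real.log t ^ 2))) volume 2 x :=
    (intervalIntegrable_iff_integrableOn_Ioc_of_le hx).2
      (integrableOn_remainder.mono_set Set.Ioc_subset_Ioi_self)
  have hloglog : ∫ t in (2 : ℝ)..x, 1 / (t * Real.log t) =
      Real.log (Real.log x) - Real.log (Real.log 2) := by
    refine intervalIntegral.integral_eq_sub_of_hasDerivAt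
      (f := fun t => Real.log (Real.log t)) (fun t ht => ?_) hI1
    rw [Set.uIcc_of_le hx] at ht
    exact hasDerivAt_log_log (by linarith [ht.1])
  have hsplit : (∫ t in Set.Ioc 2 x, deriv (fun t => (Real.log t)⁻¹) t *
        ∑ k ∈ Icc 0 ⌊t⌋₊, Λ k / (k : ℝ)) =
      -((∫ t in (2 : ℝ)..x, 1 / (t * Real.log t)) +
        ∫ t in (2 : ℝ)..x, (sumVonMangoldtDiv t - Real.log t) * (1 / (t * Real.log t ^ 2))) := by
    rw [← intervalIntegral.integral_add hI1 hI2, ← intervalIntegral.integral_neg,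
      intervalIntegral.integral_of_le hx]
    refine setIntegral_congr_fun measurableSet_Ioc fun t ht => ?_
    have ht2 : (2 : ℝ) < t := ht.1
    have h0 : t ≠ 0 := by linarith
    have h1 : Real.log t ≠ 0 := (Real.log_pos (by linarith)).ne'
    simp only [(hd t ⟨ht.1.le, ht.2⟩).deriv]
    change -(1 / (t * Real.log t ^ 2)) * sumVonMangoldtDiv t = _
    field_simp
    ring
  rw [hsplit, hloglog] at habel
  change sumVonMangoldtDivLog x = (Real.log x)⁻¹ * sumVonMangoldtDiv x - _ at habel
  rw [habel]
  field_simp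
  ring

theorem exists_tendsto_sumVonMangoldtDivLog_sub :
    ∃ c, Tendsto (fun x => sumVonMangoldtDivLog x - Real.log (Real.log x)) atTop (𝓝 c) := by
  obtain ⟨M, hM⟩ := exists_abs_sumVonMangoldtDiv_sub_log_le
  have h1 : Tendsto (fun x => (sumVonMangoldtDiv x - Real.log x) * (Real.log x)⁻¹) atTop
      (𝓝 0) := by
    refine bdd_le_mul_tendsto_zero' M ?_ (tendsto_inv_atTop_zero.comp Real.tendsto_log_atTop)
    filter_upwards [eventually_ge_atTop 1] with x hx using hM x hx
  have h2 := intervalIntegral_tendsto_integral_Ioi 2 integrableOn_remainder tendsto_id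
  refine ⟨_, ((h1.add_const (1 - Real.log (Real.log 2))).add h2).congr' ?_⟩
  filter_upwards [eventually_ge_atTop 2] with x hx
  exact (sumVonMangoldtDivLog_eq hx).symm

/-- Convergence alone bounds the difference only for large `x`; the dominated convergence below
needs a bound on all of `x ≥ 2`. -/
theorem exists_abs_sumVonMangoldtDivLog_sub_le :
    ∃ M, 0 ≤ M ∧
      ∀ x : ℝ, 2 ≤ x → |sumVonMangoldtDivLog x - Real.log (Real.log x)| ≤ M := by
  obtain ⟨M, hM⟩ := exists_abs_sumVonMangoldtDiv_sub_log_le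
  have hM0 : 0 ≤ M := (abs_nonneg _).trans (hM 1 le_rfl)
  set J := ∫ t in Set.Ioi (2 : ℝ),
    ‖(sumVonMangoldtDiv t - Real.log t) * (1 / (t * Real.log t ^ 2))‖ with hJ
  have hJ0 : 0 ≤ J := integral_nonneg fun _ => norm_nonneg _
  have hl2 : 0 < Real.log 2 := Real.log_pos (by norm_num)
  refine ⟨M * (Real.log 2)⁻¹ + |1 - Real.log (Real.log 2)| + J, by positivity, fun x hx => ?_⟩
  rw [sumVonMangoldtDivLog_eq hx]
  refine (abs_add_le _ _).trans (add_le_add ((abs_add_le _ _).trans (add_le_add ?_ le_rfl)) ?_)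
  · rw [abs_mul]
    refine mul_le_mul (hM x (by linarith)) ?_ (abs_nonneg _) hM0
    have h3 : Real.log 2 ≤ Real.log x := Real.log_le_log (by norm_num) hx
    rw [abs_of_nonneg (inv_nonneg.2 (hl2.le.trans h3))]
    exact inv_anti₀ hl2 h3
  · rw [← Real.norm_eq_abs, intervalIntegral.integral_of_le hx]
    refine (norm_integral_le_integral_norm _).trans ?_
    exact setIntegral_mono_set integrableOn_remainder.norm
      (Eventually.of_forall fun _ => norm_nonneg _) Set.Ioc_subset_Ioi_self.eventuallyLE

end Mertens

/-! ### Identification of the constant through `log ζ(1 + δ)` -/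

namespace Mertens

open Filter Topology MeasureTheory Finset ArithmeticFunction

/-- This is `Γ'(1) = -γ`, with Euler's integral differentiated under the integral sign. -/
theorem integral_log_mul_exp_neg :
    ∫ t in Set.Ioi (0 : ℝ), Real.log t * Real.exp (-t) = -Real.eulerMascheroniConstant := by
  have h1 := Complex.hasDerivAt_GammaIntegral (s := 1) (by simp)
  have h2 : Complex.Gamma =ᶠ[𝓝 1] Complex.GammaIntegral := by
    filter_upwards [(isOpen_lt continuous_const Complex.continuous_re).mem_nhds
      (show (0 : ℝ) < (1 : ℂ).re by simp)] with s hs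
    exact Complex.Gamma_eq_integral hs
  have h3 := (h1.congr_of_eventuallyEq h2).unique Complex.hasDerivAt_Gamma_one
  simp only [sub_self, Complex.cpow_zero, one_mul] at h3
  have h4 : ∫ t in Set.Ioi (0 : ℝ), ((Real.log t * Real.exp (-t) : ℝ) : ℂ) =
      ((-Real.eulerMascheroniConstant : ℝ) : ℂ) := by
    push_cast at h3 ⊢
    exact h3
  rw [integral_complex_ofReal] at h4
  exact_mod_cast h4

theorem integrableOn_log_mul_exp_neg :
    IntegrableOn (fun t : ℝ => Real.log t * Real.exp (-t)) (Set.Ioi 0) := by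
  -- A function that is not integrable has integral `0` by convention, whereas this integral is `-γ
  -- ≠ 0`.
  by_contra h
  have h1 := integral_log_mul_exp_neg
  rw [integral_undef h] at h1
  linarith [Real.one_half_lt_eulerMascheroniConstant]

theorem inv_log_mul_vonMangoldt_div_nonneg (n : ℕ) :
    0 ≤ (Real.log n)⁻¹ * (Λ n / (n : ℝ)) :=
  mul_nonneg (inv_nonneg.2 (Real.log_natCast_nonneg n))
    (div_nonneg vonMangoldt_nonneg (Nat.cast_nonneg n))

theorem inv_log_mul_vonMangoldt_div_eq_zero {n : ℕ} (hn : n < 2) :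
    (Real.log n)⁻¹ * (Λ n / (n : ℝ)) = 0 := by
  interval_cases n <;> simp

theorem vonMangoldt_div_rpow_mul_log_eq {δ : ℝ} {n : ℕ} (hn : n ≠ 0) :
    Λ n / ((n : ℝ) ^ (1 + δ) * Real.log n) =
      (Real.log n)⁻¹ * (Λ n / (n : ℝ)) * Real.exp (-(δ * Real.log n)) := by
  have hn' : (0 : ℝ) < n := by positivity
  rw [Real.rpow_add hn', Real.rpow_one, Real.exp_neg, mul_comm δ, ← Real.rpow_def_of_pos hn']
  ring

theorem summable_vonMangoldt_div_rpow_mul_log {s : ℝ} (hs : 1 < s) :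
    Summable fun n : ℕ => Λ n / ((n : ℝ) ^ s * Real.log n) := by
  refine (Real.summable_one_div_nat_rpow.2 hs).of_nonneg_of_le (fun n => ?_) (fun n => ?_)
  · exact div_nonneg vonMangoldt_nonneg
      (mul_nonneg (Real.rpow_nonneg (Nat.cast_nonneg n) _) (Real.log_natCast_nonneg n))
  · have h0 : 0 ≤ 1 / (n : ℝ) ^ s := by positivity
    calc Λ n / ((n : ℝ) ^ s * Real.log n) = 1 / (n : ℝ) ^ s * (Λ n / Real.log n) := by ring
      _ ≤ 1 / (n : ℝ) ^ s * 1 := by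
        refine mul_le_mul_of_nonneg_left ?_ h0
        exact div_le_one_of_le₀ vonMangoldt_le_log (Real.log_natCast_nonneg n)
      _ = _ := mul_one _

theorem integrableOn_indicator_exp_neg (a : ℝ) :
    IntegrableOn ((Set.Ici a).indicator fun t => Real.exp (-t)) (Set.Ioi 0) :=
  Integrable.indicator (integrableOn_exp_neg_Ioi 0) measurableSet_Ici

theorem integral_indicator_exp_neg {a : ℝ} (ha : 0 < a) :
    ∫ t in Set.Ioi (0 : ℝ), (Set.Ici a).indicator (fun t => Real.exp (-t)) t =
      Real.exp (-a) := by
  rw [setIntegral_indicator measurableSet_Ici, Set.inter_eq_right.2 (fun t ht => ?_),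
    integral_Ici_eq_integral_Ioi, integral_exp_neg_Ioi]
  exact ha.trans_le ht

/-- The condition `δ log n ≤ t` means `n ≤ exp (t / δ)`, so the series is a finite partial sum. -/
theorem tsum_indicator_eq {δ t : ℝ} (hδ : 0 < δ) :
    ∑' n : ℕ, (Real.log n)⁻¹ * (Λ n / (n : ℝ)) *
        (Set.Ici (δ * Real.log n)).indicator (fun t => Real.exp (-t)) t =
      sumVonMangoldtDivLog (Real.exp (t / δ)) * Real.exp (-t) := by
  have key : ∀ n : ℕ, n ≠ 0 → (n ∈ Icc 0 ⌊Real.exp (t / δ)⌋₊ ↔ t ∈ Set.Ici (δ * Real.log n)) := by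
    intro n hn
    rw [mem_Icc, Nat.le_floor_iff (Real.exp_pos _).le, ← Real.log_le_iff_le_exp (by positivity),
      le_div_iff₀ hδ, Set.mem_Ici, mul_comm]
    simp
  rw [tsum_eq_sum (s := Icc 0 ⌊Real.exp (t / δ)⌋₊), sumVonMangoldtDivLog, sum_mul]
  · refine sum_congr rfl fun n hn => ?_
    rcases eq_or_ne n 0 with rfl | h0
    · simp
    · rw [Set.indicator_of_mem ((key n h0).1 hn)]
  · intro n hn
    rcases eq_or_ne n 0 with rfl | h0
    · simp
    · rw [Set.indicator_of_notMem (fun h => hn ((key n h0).2 h)), mul_zero]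

/-- The Dirichlet series of `log ζ` as a Laplace transform. -/
theorem integral_sumVonMangoldtDivLog {δ : ℝ} (hδ : 0 < δ) :
    ∫ t in Set.Ioi (0 : ℝ), sumVonMangoldtDivLog (Real.exp (t / δ)) * Real.exp (-t) =
      Real.log (riemannZeta ((1 + δ : ℝ) : ℂ)).re := by
  set F : ℕ → ℝ → ℝ := fun n t => (Real.log n)⁻¹ * (Λ n / (n : ℝ)) *
    (Set.Ici (δ * Real.log n)).indicator (fun t => Real.exp (-t)) t with hF
  have hF0 : ∀ n t, 0 ≤ F n t := fun n t => mul_nonneg (inv_log_mul_vonMangoldt_div_nonneg n)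
    (Set.indicator_nonneg (fun _ _ => (Real.exp_pos _).le) _)
  have hFint : ∀ n, Integrable (F n) (volume.restrict (Set.Ioi 0)) :=
    fun n => (integrableOn_indicator_exp_neg _).const_mul _
  -- Here `n ^ (-δ)` is the integral of `exp (-t)` over `t ≥ δ log n`. For `n < 2` both sides
  -- vanish.
  have hFval : ∀ n, ∫ t in Set.Ioi (0 : ℝ), F n t = Λ n / ((n : ℝ) ^ (1 + δ) * Real.log n) := by
    intro n
    rcases lt_or_ge n 2 with hn | hn
    · simp only [hF, inv_log_mul_vonMangoldt_div_eq_zero hn, zero_mul, integral_zero]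
      interval_cases n <;> simp
    · rw [vonMangoldt_div_rpow_mul_log_eq (by lia)]
      simp only [hF]
      have : 0 < Real.log n := Real.log_pos (by exact_mod_cast hn)
      rw [integral_const_mul, integral_indicator_exp_neg (by positivity)]
  have hsum : Summable fun n => ∫ t in Set.Ioi (0 : ℝ), ‖F n t‖ := by
    simp_rw [Real.norm_of_nonneg (hF0 _ _), hFval]
    exact summable_vonMangoldt_div_rpow_mul_log (by linarith)
  have h1 := hasSum_integral_of_summable_integral_norm hFint hsum
  have h2 : ∀ t, ∑' n, F n t = sumVonMangoldtDivLog (Real.exp (t / δ)) * Real.exp (-t) :=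
    fun t => tsum_indicator_eq hδ
  simp_rw [h2, hFval] at h1
  have h3 := log_riemannZeta_eq (s := 1 + δ) (by linarith)
  rw [h3, h1.tsum_eq]

theorem measurable_sumVonMangoldtDivLog : Measurable sumVonMangoldtDivLog :=
  (measurable_from_nat
    (f := fun m => ∑ n ∈ Icc 0 m, (Real.log n)⁻¹ * (Λ n / (n : ℝ)))).comp Nat.measurable_floor

theorem sumVonMangoldtDivLog_eq_zero {x : ℝ} (hx : x < 2) : sumVonMangoldtDivLog x = 0 := by
  refine sum_eq_zero fun n hn => inv_log_mul_vonMangoldt_div_eq_zero ?_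
  exact (mem_Icc.1 hn).2.trans_lt ((Nat.floor_lt' two_ne_zero).2 hx)

/-- At `x = exp (t / δ)` one has `log log x = log t - log δ`. If `x < 2` the sum is empty of nonzero
terms and `t < δ < 1`, so `|log δ| ≤ |log t|`. The bound is uniform in `δ` and integrable against
`exp (-t)`. -/
theorem exists_abs_sumVonMangoldtDivLog_add_log_le :
    ∃ M, ∀ δ t : ℝ, 0 < δ → δ < 1 → 0 < t →
      |sumVonMangoldtDivLog (Real.exp (t / δ)) + Real.log δ| ≤ M + |Real.log t| := by
  obtain ⟨M, hM0, hM⟩ := exists_abs_sumVonMangoldtDivLog_sub_le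
  refine ⟨M, fun δ t hδ hδ1 ht => ?_⟩
  rcases lt_or_ge (Real.exp (t / δ)) 2 with h | h
  · rw [sumVonMangoldtDivLog_eq_zero h, zero_add]
    have h1 : t / δ < 1 := by
      have := Real.add_one_le_exp (t / δ)
      linarith
    have h2 : Real.log t ≤ Real.log δ := Real.log_le_log ht ((div_lt_one hδ).1 h1).le
    have h3 : Real.log δ ≤ 0 := Real.log_nonpos hδ.le hδ1.le
    rw [abs_of_nonpos h3, abs_of_nonpos (h2.trans h3)]
    linarith
  · have h1 := hM _ h
    rw [Real.log_exp, Real.log_div ht.ne' hδ.ne'] at h1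
    calc |sumVonMangoldtDivLog (Real.exp (t / δ)) + Real.log δ|
        = |(sumVonMangoldtDivLog (Real.exp (t / δ)) - (Real.log t - Real.log δ)) +
            Real.log t| := by ring_nf
      _ ≤ _ := (abs_add_le _ _).trans (add_le_add h1 le_rfl)

/-- The constant in Mertens' second theorem for the von Mangoldt function is Euler's constant. -/
theorem tendsto_sumVonMangoldtDivLog_sub :
    Tendsto (fun x => sumVonMangoldtDivLog x - Real.log (Real.log x)) atTop
      (𝓝 Real.eulerMascheroniConstant) := by
  obtain ⟨c, hc⟩ := exists_tendsto_sumVonMangoldtDivLog_sub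
  obtain ⟨M, hM⟩ := exists_abs_sumVonMangoldtDivLog_add_log_le
  set h : ℝ → ℝ → ℝ := fun δ t =>
    (sumVonMangoldtDivLog (Real.exp (t / δ)) + Real.log δ) * Real.exp (-t) with hh
  set bound : ℝ → ℝ := fun t => M * Real.exp (-t) + |Real.log t * Real.exp (-t)| with hbound
  have hbound_int : IntegrableOn bound (Set.Ioi 0) :=
    ((integrableOn_exp_neg_Ioi 0).const_mul M).add integrableOn_log_mul_exp_neg.abs
  have hmeas : ∀ δ, AEStronglyMeasurable (h δ) (volume.restrict (Set.Ioi 0)) := fun δ => by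
    have : Measurable fun t : ℝ => sumVonMangoldtDivLog (Real.exp (t / δ)) :=
      measurable_sumVonMangoldtDivLog.comp (by fun_prop)
    exact ((this.add_const _).mul (by fun_prop)).aestronglyMeasurable
  have hle : ∀ δ, 0 < δ → δ < 1 → ∀ᵐ t ∂volume.restrict (Set.Ioi (0 : ℝ)),
      ‖h δ t‖ ≤ bound t := by
    intro δ hδ hδ1
    filter_upwards [ae_restrict_mem measurableSet_Ioi] with t ht
    simp only [hh, hbound]
    rw [Real.norm_eq_abs, abs_mul, abs_mul, Real.abs_exp, ← add_mul]
    exact mul_le_mul_of_nonneg_right (hM δ t hδ hδ1 ht) (Real.exp_pos _).le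
  have hev : ∀ᶠ δ in 𝓝[>] (0 : ℝ), 0 < δ ∧ δ < 1 := Ioo_mem_nhdsGT one_pos
  -- As `δ → 0` the integrals tend to that of `(c + log t) exp (-t)`, which is `c - γ`.
  have hlim := tendsto_integral_filter_of_dominated_convergence
    (μ := volume.restrict (Set.Ioi (0 : ℝ))) (F := h) (l := 𝓝[>] (0 : ℝ))
    (f := fun t => (c + Real.log t) * Real.exp (-t)) bound
    (Eventually.of_forall hmeas) (hev.mono fun δ hδ => hle δ hδ.1 hδ.2) hbound_int (by
      filter_upwards [ae_restrict_mem measurableSet_Ioi] with t ht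
      have ht : 0 < t := ht
      have h1 : Tendsto (fun δ : ℝ => Real.exp (t / δ)) (𝓝[>] 0) atTop :=
        Real.tendsto_exp_atTop.comp (tendsto_inv_nhdsGT_zero.const_mul_atTop ht)
      refine Tendsto.mul_const _ (((hc.comp h1).add_const (Real.log t)).congr' ?_)
      filter_upwards [hev] with δ hδ
      simp only [Function.comp_apply, Real.log_exp, Real.log_div ht.ne' hδ.1.ne']
      ring)
  have hval : ∀ᶠ δ in 𝓝[>] (0 : ℝ), ∫ t in Set.Ioi (0 : ℝ), h δ t =
      Real.log (riemannZeta ((1 + δ : ℝ) : ℂ)).re + Real.log (1 + δ - 1) := by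
    filter_upwards [hev] with δ hδ
    have h1 : IntegrableOn (h δ) (Set.Ioi 0) := hbound_int.mono' (hmeas δ) (hle δ hδ.1 hδ.2)
    have h2 : IntegrableOn (fun t => Real.log δ * Real.exp (-t)) (Set.Ioi 0) :=
      (integrableOn_exp_neg_Ioi 0).const_mul _
    rw [← integral_sumVonMangoldtDivLog hδ.1, ← sub_eq_iff_eq_add, add_sub_cancel_left]
    have h3 : Real.log δ = ∫ t in Set.Ioi (0 : ℝ), Real.log δ * Real.exp (-t) := by
      rw [integral_const_mul, integral_exp_neg_Ioi_zero, mul_one]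
    nth_rw 1 [h3]
    rw [← integral_sub h1 h2]
    refine integral_congr_ae (Eventually.of_forall fun t => ?_)
    simp only [hh]
    ring
  -- The same integrals equal `log ζ(1 + δ) + log δ`, which tends to `0` because `ζ` has a simple
  -- pole of residue `1`. Hence `c = γ`.
  have hzero : Tendsto (fun δ => ∫ t in Set.Ioi (0 : ℝ), h δ t) (𝓝[>] (0 : ℝ)) (𝓝 0) := by
    have h1 := (Asymptotics.isLittleO_one_iff ℝ).1 log_riemannZeta_add_log_sub_isLittleO_ofReal
    have h2 : Tendsto (fun δ : ℝ => 1 + δ) (𝓝[>] 0) (𝓝[>] 1) := by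
      refine tendsto_nhdsWithin_of_tendsto_nhds_of_eventually_within _ ?_ ?_
      · have : Tendsto (fun δ : ℝ => 1 + δ) (𝓝 0) (𝓝 (1 + 0)) := tendsto_id.const_add 1
        rw [add_zero] at this
        exact this.mono_left nhdsWithin_le_nhds
      · filter_upwards [hev] with δ hδ
        have := hδ.1
        simpa using this
    exact (h1.comp h2).congr' (hval.mono fun δ hδ => hδ.symm)
  have hc0 := tendsto_nhds_unique hlim hzero
  simp_rw [add_mul] at hc0
  rw [integral_add ((integrableOn_exp_neg_Ioi 0).const_mul c) integrableOn_log_mul_exp_neg,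
    integral_const_mul, integral_exp_neg_Ioi_zero, integral_log_mul_exp_neg] at hc0
  have : c = Real.eulerMascheroniConstant := by linarith
  rwa [this] at hc

end Mertens

/-! ### From prime powers to primes: the upper bound in Mertens' third theorem -/

namespace Mertens

open Filter Topology MeasureTheory Finset ArithmeticFunction

theorem inv_log_mul_vonMangoldt_prime_pow {p : ℕ} (hp : p.Prime) (i : ℕ) :
    (Real.log ((p ^ (i + 1) : ℕ) : ℝ))⁻¹ * (Λ (p ^ (i + 1)) / ((p ^ (i + 1) : ℕ) : ℝ)) =
      ((p : ℝ)⁻¹) ^ (i + 1) / (i + 1) := by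
  have h1 : Real.log p ≠ 0 := (Real.log_pos (by exact_mod_cast hp.one_lt)).ne'
  have h2 : (p : ℝ) ≠ 0 := by exact_mod_cast hp.ne_zero
  rw [vonMangoldt_apply_pow (Nat.succ_ne_zero i), vonMangoldt_apply_prime hp, Nat.cast_pow,
    Real.log_pow, inv_pow]
  push_cast
  field_simp

/-- The left side collects the terms of the right side at the prime powers `p ^ k ≤ N`, which are
pairwise distinct. -/
theorem sum_primesLE_sum_le_sumVonMangoldtDivLog (N : ℕ) :
    ∑ p ∈ Nat.primesLE N, ∑ i ∈ range (p.log N), ((p : ℝ)⁻¹) ^ (i + 1) / (i + 1) ≤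
      sumVonMangoldtDivLog N := by
  have h1 : ∀ p ∈ Nat.primesLE N,
      ∑ i ∈ range (p.log N), ((p : ℝ)⁻¹) ^ (i + 1) / ((i : ℝ) + 1) =
        ∑ q ∈ (range (p.log N)).image (fun i => p ^ (i + 1)),
          (Real.log q)⁻¹ * (Λ q / (q : ℝ)) := by
    intro p hp
    have hp' := Nat.prime_of_mem_primesLE hp
    rw [sum_image fun a _ b _ hab => Nat.succ_injective (Nat.pow_right_injective hp'.two_le hab)]
    exact sum_congr rfl fun i _ => (inv_log_mul_vonMangoldt_prime_pow hp' i).symm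
  rw [sum_congr rfl h1, ← sum_biUnion, sumVonMangoldtDivLog, Nat.floor_natCast]
  · refine sum_le_sum_of_subset_of_nonneg (fun q hq => ?_)
      fun n _ _ => inv_log_mul_vonMangoldt_div_nonneg n
    obtain ⟨p, hp, hq⟩ := mem_biUnion.1 hq
    obtain ⟨i, hi, rfl⟩ := mem_image.1 hq
    refine mem_Icc.2 ⟨Nat.zero_le _, ?_⟩
    have hN : N ≠ 0 := by
      rintro rfl
      simp at hi
    exact Nat.pow_le_of_le_log hN (mem_range.1 hi)
  · intro p hp q hq hpq
    refine disjoint_left.2 fun m hm hm' => hpq ?_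
    obtain ⟨i, -, rfl⟩ := mem_image.1 hm
    obtain ⟨j, -, hj⟩ := mem_image.1 hm'
    exact ((Nat.prime_of_mem_primesLE hp).pow_inj (Nat.prime_of_mem_primesLE hq) hj.symm).1

theorem neg_log_one_sub_inv_le {p N : ℕ} (hp : p.Prime) (hpN : p ≤ N) :
    -Real.log (1 - (p : ℝ)⁻¹) ≤
      ∑ i ∈ range (p.log N), ((p : ℝ)⁻¹) ^ (i + 1) / (i + 1) +
        2 * (N : ℝ) ^ (-(1 / 4) : ℝ) * (p : ℝ) ^ (-(3 / 2) : ℝ) := by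
  have hp2 : (2 : ℝ) ≤ p := by exact_mod_cast hp.two_le
  have hp0 : (0 : ℝ) < p := by linarith
  have hN0 : (0 : ℝ) < N := by exact_mod_cast hp.pos.trans_le hpN
  have hinv : (p : ℝ)⁻¹ ≤ 1 / 2 := by
    rw [← one_div]
    exact one_div_le_one_div_of_le (by norm_num) hp2
  have hinv0 : 0 < (p : ℝ)⁻¹ := by positivity
  have habs : |(p : ℝ)⁻¹| = (p : ℝ)⁻¹ := abs_of_pos hinv0
  have h1 := Real.abs_log_sub_add_sum_range_le (x := (p : ℝ)⁻¹) (by rw [habs]; linarith) (p.log N)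
  rw [habs] at h1
  have h2 := neg_le_of_abs_le h1
  set K := p.log N with hK
  have hK1 : 1 ≤ K := Nat.log_pos hp.one_lt hpN
  set P : ℝ := (p : ℝ) ^ (K + 1) with hP
  have hP0 : 0 < P := by positivity
  have h3 : (N : ℝ) ≤ P := by
    rw [hP]
    exact_mod_cast (Nat.lt_pow_succ_log_self hp.one_lt N).le
  have h4 : (p : ℝ) ^ (2 : ℝ) ≤ P := by
    rw [Real.rpow_two]
    exact pow_le_pow_right₀ (by linarith) (by lia)
  -- The truncated tail of the logarithm series is at most `2 / P`. Since `P ≥ N` and `P ≥ p ^ 2`,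
  -- splitting the exponent as `1/4 + 3/4` gives a factor tending to `0` with `N` and a factor
  -- summable over `p`.
  have h5 : P⁻¹ ≤ (N : ℝ) ^ (-(1 / 4) : ℝ) * (p : ℝ) ^ (-(3 / 2) : ℝ) := by
    have h6 : P⁻¹ = P ^ (-(1 / 4) : ℝ) * P ^ (-(3 / 4) : ℝ) := by
      rw [← Real.rpow_add hP0, ← Real.rpow_neg_one]
      norm_num
    rw [h6]
    refine mul_le_mul (Real.rpow_le_rpow_of_nonpos hN0 h3 (by norm_num)) ?_ (by positivity)
      (by positivity)
    calc P ^ (-(3 / 4) : ℝ) ≤ ((p : ℝ) ^ (2 : ℝ)) ^ (-(3 / 4) : ℝ) :=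
          Real.rpow_le_rpow_of_nonpos (by positivity) h4 (by norm_num)
      _ = _ := by
        rw [← Real.rpow_mul hp0.le]
        norm_num
  have h7 : (p : ℝ)⁻¹ ^ (K + 1) / (1 - (p : ℝ)⁻¹) ≤ 2 * P⁻¹ := by
    rw [inv_pow, div_le_iff₀ (by linarith)]
    have : 0 < P⁻¹ := by positivity
    nlinarith
  linarith

theorem sum_primesLE_neg_log_le (N : ℕ) :
    ∑ p ∈ Nat.primesLE N, -Real.log (1 - (p : ℝ)⁻¹) ≤ sumVonMangoldtDivLog N +
      2 * (N : ℝ) ^ (-(1 / 4) : ℝ) * ∑' n : ℕ, (n : ℝ) ^ (-(3 / 2) : ℝ) := by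
  have hs : Summable fun n : ℕ => (n : ℝ) ^ (-(3 / 2) : ℝ) :=
    Real.summable_nat_rpow.2 (by norm_num)
  calc ∑ p ∈ Nat.primesLE N, -Real.log (1 - (p : ℝ)⁻¹)
      ≤ ∑ p ∈ Nat.primesLE N, (∑ i ∈ range (p.log N), ((p : ℝ)⁻¹) ^ (i + 1) / (i + 1) +
        2 * (N : ℝ) ^ (-(1 / 4) : ℝ) * (p : ℝ) ^ (-(3 / 2) : ℝ)) :=
        sum_le_sum fun p hp => neg_log_one_sub_inv_le (Nat.prime_of_mem_primesLE hp)
          (Nat.mem_primesLE.1 hp).1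
    _ ≤ _ := by
      rw [sum_add_distrib, ← mul_sum]
      refine add_le_add (sum_primesLE_sum_le_sumVonMangoldtDivLog N) ?_
      refine mul_le_mul_of_nonneg_left ?_ (by positivity)
      exact hs.sum_le_tsum _ fun n _ => by positivity

/-- The upper bound in Mertens' third theorem. -/
theorem eventually_sum_primesLE_neg_log_le {γ' : ℝ} (h : Real.eulerMascheroniConstant < γ') :
    ∀ᶠ x : ℝ in atTop,
      ∑ p ∈ Nat.primesLE ⌊x⌋₊, -Real.log (1 - (p : ℝ)⁻¹) ≤ Real.log (Real.log x) + γ' := by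
  have h1 : Tendsto (fun x : ℝ => 2 * (⌊x⌋₊ : ℝ) ^ (-(1 / 4) : ℝ) *
      ∑' n : ℕ, (n : ℝ) ^ (-(3 / 2) : ℝ)) atTop (𝓝 0) := by
    have h2 := (tendsto_rpow_neg_atTop (show (0 : ℝ) < 1 / 4 by norm_num)).comp
      (tendsto_natCast_atTop_atTop.comp (tendsto_nat_floor_atTop (α := ℝ)))
    simpa using (h2.const_mul 2).mul_const (∑' n : ℕ, (n : ℝ) ^ (-(3 / 2) : ℝ))
  have h3 := tendsto_sumVonMangoldtDivLog_sub.add h1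
  rw [add_zero] at h3
  filter_upwards [h3.eventually_lt_const h] with x hx
  have h4 := sum_primesLE_neg_log_le ⌊x⌋₊
  have h5 : sumVonMangoldtDivLog (⌊x⌋₊ : ℝ) = sumVonMangoldtDivLog x := by
    simp [sumVonMangoldtDivLog]
  rw [h5] at h4
  linarith

/-! ### Landau's lower bound for `φ(n)/n` -/

theorem card_filter_primeFactors_mul_log_le {n : ℕ} (hn : n ≠ 0) {L : ℝ} (hL : 0 < L) :
    (#{p ∈ n.primeFactors | L < (p : ℕ)} : ℝ) * Real.log L ≤ Real.log n := by
  have h1 : ∑ _p ∈ n.primeFactors with L < (_p : ℕ), Real.log L ≤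
      ∑ p ∈ n.primeFactors, Real.log p :=
    (sum_le_sum fun p hp => Real.log_le_log hL (mem_filter.1 hp).2.le).trans
      (sum_le_sum_of_subset_of_nonneg (filter_subset _ _)
        fun p _ _ => Real.log_natCast_nonneg p)
  rw [sum_const, nsmul_eq_mul] at h1
  refine h1.trans ?_
  rw [← Real.log_prod fun p hp => by exact_mod_cast (Nat.prime_of_mem_primeFactors hp).ne_zero,
    ← Nat.cast_prod]
  refine Real.log_le_log ?_ (by exact_mod_cast Nat.le_of_dvd (by lia) (Nat.prod_primeFactors_dvd n))
  exact_mod_cast prod_pos fun p hp => (Nat.prime_of_mem_primeFactors hp).pos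

theorem log_totient_div {n : ℕ} (hn : n ≠ 0) :
    Real.log (n.totient / n) = ∑ p ∈ n.primeFactors, Real.log (1 - (p : ℝ)⁻¹) := by
  have h1 : (n.totient : ℝ) = n * ∏ p ∈ n.primeFactors, (1 - (p : ℝ)⁻¹) := by
    have h := congrArg (Rat.cast : ℚ → ℝ) (Nat.totient_eq_mul_prod_factors n)
    push_cast at h
    exact h
  have h2 : (n : ℝ) ≠ 0 := by exact_mod_cast hn
  rw [h1, mul_div_cancel_left₀ _ h2, Real.log_prod]
  intro p hp
  have : (2 : ℝ) ≤ p := by exact_mod_cast (Nat.prime_of_mem_primeFactors hp).two_le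
  have : (p : ℝ)⁻¹ ≤ 2⁻¹ := inv_anti₀ (by norm_num) this
  linarith

/-- The prime factors up to `L = log n` are bounded by all primes up to `L`. There are at most `L /
log L` larger ones, as their product is at most `n`, and each contributes at most `1 / (p - 1) ≤ 2 /
L`. -/
theorem neg_log_totient_div_le {n : ℕ} (hn : n ≠ 0) {L : ℝ} (hL : L = Real.log n) (hL2 : 2 ≤ L) :
    -Real.log (n.totient / n) ≤
      ∑ p ∈ Nat.primesLE ⌊L⌋₊, -Real.log (1 - (p : ℝ)⁻¹) + 2 / Real.log L := by
  have hw : ∀ p : ℕ, p.Prime → 0 ≤ -Real.log (1 - (p : ℝ)⁻¹) ∧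
      -Real.log (1 - (p : ℝ)⁻¹) ≤ 1 / (p - 1) := by
    intro p hp
    have h2 : (2 : ℝ) ≤ p := by exact_mod_cast hp.two_le
    have h3 : (p : ℝ)⁻¹ ≤ 2⁻¹ := inv_anti₀ (by norm_num) h2
    have h4 : 0 < (p : ℝ)⁻¹ := by positivity
    refine ⟨neg_nonneg.2 (Real.log_nonpos (by linarith) (by linarith)), ?_⟩
    have h5 := Real.one_sub_inv_le_log_of_pos (show 0 < 1 - (p : ℝ)⁻¹ by linarith)
    have h6 : 1 - (1 - (p : ℝ)⁻¹)⁻¹ = -(1 / (p - 1)) := by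
      have : (p : ℝ) - 1 ≠ 0 := by linarith
      have h0 : (p : ℝ) ≠ 0 := by linarith
      have h7 : 1 - (p : ℝ)⁻¹ = (p - 1) / p := by field_simp
      rw [h7]
      field_simp
      ring
    linarith
  have hlogL : 0 < Real.log L := Real.log_pos (by linarith)
  rw [log_totient_div hn, ← sum_neg_distrib,
    ← sum_filter_add_sum_filter_not _ (fun p : ℕ => L < (p : ℕ)), add_comm]
  refine add_le_add ?_ ?_
  · refine sum_le_sum_of_subset_of_nonneg (fun p hp => ?_)
      fun p hp _ => (hw p (Nat.prime_of_mem_primesLE hp)).1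
    obtain ⟨h1, h2⟩ := mem_filter.1 hp
    exact Nat.mem_primesLE.2 ⟨Nat.le_floor (not_lt.1 h2), Nat.prime_of_mem_primeFactors h1⟩
  · have hcard := card_filter_primeFactors_mul_log_le hn (show 0 < L by linarith)
    rw [← hL] at hcard
    calc ∑ p ∈ n.primeFactors with L < (p : ℕ), -Real.log (1 - (p : ℝ)⁻¹)
        ≤ ∑ _p ∈ n.primeFactors with L < (_p : ℕ), 2 / L := by
          refine sum_le_sum fun p hp => ?_
          obtain ⟨h1, h2⟩ := mem_filter.1 hp
          refine (hw p (Nat.prime_of_mem_primeFactors h1)).2.trans ?_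
          rw [div_le_div_iff₀ (by linarith) (by linarith)]
          linarith
      _ = (#{p ∈ n.primeFactors | L < (p : ℕ)} : ℝ) * (2 / L) := by
          rw [sum_const, nsmul_eq_mul]
      _ ≤ L / Real.log L * (2 / L) :=
          mul_le_mul_of_nonneg_right ((le_div_iff₀ hlogL).2 hcard) (by positivity)
      _ = 2 / Real.log L := by
          field_simp

/-- This strict inequality is what makes the factor `2` in the number of runs sufficient. -/
theorem eulerMascheroniConstant_lt_log_two : Real.eulerMascheroniConstant < Real.log 2 := by
  linarith [Real.eulerMascheroniConstant_lt_two_thirds, Real.log_two_gt_d9]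

/-- Landau's lower bound for the totient, with the constant `1/2 < exp (-γ)`. -/
theorem eventually_one_le_totient_div_mul_log_log :
    ∀ᶠ n : ℕ in atTop,
      1 ≤ 2 * Real.log (Real.log n) * ((n.totient : ℝ) / n) := by
  -- The gap `log 2 - γ'` absorbs the error `2 / log log n` from the large prime factors.
  obtain ⟨γ', hγ1, hγ2⟩ := exists_between eulerMascheroniConstant_lt_log_two
  have hlog : Tendsto (fun n : ℕ => Real.log n) atTop atTop :=
    Real.tendsto_log_atTop.comp tendsto_natCast_atTop_atTop
  have hloglog := Real.tendsto_log_atTop.comp hlog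
  have hsmall : Tendsto (fun n : ℕ => 2 / Real.log (Real.log n)) atTop (𝓝 0) :=
    hloglog.const_div_atTop 2
  filter_upwards [hlog.eventually (eventually_sum_primesLE_neg_log_le hγ1),
    hlog.eventually_ge_atTop 2, hloglog.eventually_gt_atTop 0,
    hsmall.eventually_lt_const (sub_pos.2 hγ2), eventually_gt_atTop 0] with n h1 h2 h3 h4 h5
  have h3 : 0 < Real.log (Real.log n) := h3
  have h6 := neg_log_totient_div_le h5.ne' rfl h2
  have h7 : (0 : ℝ) < n.totient / n := by
    have := Nat.totient_pos.2 h5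
    positivity
  rw [← Real.log_nonneg_iff (by positivity), Real.log_mul (by positivity) h7.ne',
    Real.log_mul two_ne_zero h3.ne']
  linarith

end Mertens

/-! ### Discrete logarithms and the state before the measurement -/

namespace TkAlgorithm

open Finset

section BasisMap

variable {ι κ : Type*} [Fintype ι]

theorem basisMap_apply_of_unique {f : ι → κ} (ψ : Ket ι) {y : κ} {i : ι}
    (h : ∀ j, f j = y ↔ j = i) : basisMap f ψ y = ψ i := by
  classical
  simp [basisMap, h]

end BasisMap

variable {F : Type*} [Field F] [Fintype F] {u : Fˣ}

/-- Powers of `ζ` become a primitive additive character of `ℤ/(q-1)`, so exponents may be reduced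
and orthogonality applies. -/
theorem zeta_pow (k : ℕ) : zeta F ^ k = ZMod.stdAddChar ((k : ℕ) : Idx F) := by
  have h := ZMod.stdAddChar_coe (N := Fintype.card F - 1) (k : ℤ)
  rw [Int.cast_natCast] at h
  rw [h, zeta, ← Complex.exp_nat_mul]
  congr 1
  push_cast
  ring

theorem orderOf_generator (hu : ∀ x : Fˣ, x ∈ Subgroup.zpowers u) :
    orderOf u = Fintype.card F - 1 := by
  classical
  rw [orderOf_eq_card_of_forall_mem_zpowers hu, Nat.card_eq_fintype_card, Fintype.card_units]

theorem generator_pow_eq_iff (hu : ∀ x : Fˣ, x ∈ Subgroup.zpowers u) {a b : ℕ} :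
    (u : F) ^ a = (u : F) ^ b ↔ (a : Idx F) = b := by
  rw [← Units.val_pow_eq_pow_val, ← Units.val_pow_eq_pow_val, Units.val_inj, pow_eq_pow_iff_modEq,
    orderOf_generator hu, ZMod.natCast_eq_natCast_iff]

theorem generator_pow_discreteLog (hu : ∀ x : Fˣ, x ∈ Subgroup.zpowers u) {x : F} (hx : x ≠ 0) :
    (u : F) ^ discreteLog u x = x := by
  have h : {j : ℕ | (u : F) ^ j = x}.Nonempty := by
    obtain ⟨j, hj⟩ := mem_powers_iff_mem_zpowers.2 (hu (Units.mk0 x hx))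
    exact ⟨j, by simpa using congrArg Units.val hj⟩
  exact Nat.sInf_mem h

theorem discreteLog_lt (hu : ∀ x : Fˣ, x ∈ Subgroup.zpowers u) {x : F} (hx : x ≠ 0) :
    discreteLog u x < Fintype.card F - 1 := by
  have h : (u : F) ^ (discreteLog u x % (Fintype.card F - 1)) = x := by
    conv_rhs => rw [← generator_pow_discreteLog hu hx]
    rw [generator_pow_eq_iff hu, ZMod.natCast_mod]
  exact (Nat.sInf_le h).trans_lt (Nat.mod_lt _ (Nat.pos_of_neZero _))

theorem discreteLog_cast_inj (hu : ∀ x : Fˣ, x ∈ Subgroup.zpowers u) {x y : F} (hx : x ≠ 0)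
    (hy : y ≠ 0) : (discreteLog u x : Idx F) = discreteLog u y ↔ x = y := by
  rw [← generator_pow_eq_iff hu, generator_pow_discreteLog hu hx, generator_pow_discreteLog hu hy]

theorem generator_pow_val_eq_iff (hu : ∀ x : Fˣ, x ∈ Subgroup.zpowers u) {y : F} (hy : y ≠ 0)
    (j : Idx F) : (u : F) ^ j.val = y ↔ j = discreteLog u y := by
  conv_lhs => rw [← generator_pow_discreteLog hu hy]
  rw [generator_pow_eq_iff hu, ZMod.natCast_zmod_val]

theorem opV_initialState_apply (v : Ket F) (r : Idx F) (x : F) (s : Idx F) (z : F) :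
    opV u (initialState v) (r, x, s, z) =
      initialState v (r, x, s, z - x ^ r.val * (u : F) ^ s.val) := by
  refine basisMap_apply_of_unique _ ?_
  rintro ⟨r', x', s', z'⟩
  simp only [Prod.mk.injEq]
  constructor
  · rintro ⟨rfl, rfl, rfl, rfl⟩
    simp
  · rintro ⟨rfl, rfl, rfl, rfl⟩
    simp

theorem qftEntry_mul_qftEntry (l r m s : Idx F) :
    qftEntry F l r * qftEntry F m s =
      ZMod.stdAddChar (l * r + m * s) / ((Fintype.card F - 1 : ℕ) : ℂ) := by
  have h : ((Real.sqrt ((Fintype.card F - 1 : ℕ) : ℝ) : ℝ) : ℂ) *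
      (Real.sqrt ((Fintype.card F - 1 : ℕ) : ℝ) : ℝ) = ((Fintype.card F - 1 : ℕ) : ℂ) := by
    rw [← Complex.ofReal_mul, Real.mul_self_sqrt (Nat.cast_nonneg _), Complex.ofReal_natCast]
  rw [qftEntry, qftEntry, div_mul_div_comm, h, zeta_pow, zeta_pow, ← AddChar.map_add_eq_mul]
  simp

theorem preMeasure_apply_zero {v : Ket F} (hv : v 0 = 0) (l : Idx F) (x : F) (m : Idx F) :
    preMeasure u v (l, x, m, 0) = 0 := by
  refine sum_eq_zero fun r _ => sum_eq_zero fun s _ => ?_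
  rw [opV_initialState_apply]
  rcases eq_or_ne x 0 with rfl | hx
  · simp [initialState, hv]
  · have : x ^ r.val * (u : F) ^ s.val ≠ 0 := mul_ne_zero (pow_ne_zero _ hx) (by simp)
    simp [initialState, this]

open Classical in
/-- The state before the measurement, on the outcomes with nonzero fourth register. -/
theorem preMeasure_apply (hu : ∀ x : Fˣ, x ∈ Subgroup.zpowers u) {v : Ket F} (hv : v 0 = 0)
    (l : Idx F) (x : F) (m : Idx F) {z : F} (hz : z ≠ 0) :
    preMeasure u v (l, x, m, z) =
      ZMod.stdAddChar (m * (discreteLog u z : Idx F)) / ((Fintype.card F - 1 : ℕ) : ℂ) *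
        if l = m * discreteLog u x then v x else 0 := by
  rcases eq_or_ne x 0 with rfl | hx
  · rw [hv, ite_self, mul_zero]
    refine sum_eq_zero fun r _ => sum_eq_zero fun s _ => ?_
    rw [opV_initialState_apply]
    simp [initialState, hv]
  set n : ℂ := ((Fintype.card F - 1 : ℕ) : ℂ) with hn
  have hn0 : n ≠ 0 := by
    rw [hn]
    exact_mod_cast NeZero.ne (Fintype.card F - 1)
  set a : Idx F := ((discreteLog u x : ℕ) : Idx F) with ha
  set t : Idx F := ((discreteLog u z : ℕ) : Idx F) with ht
  -- Taking logarithms turns `z = x ^ r u ^ s` into `t = a r + s`: for each `r` a single `s`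
  -- survives.
  have hcond : ∀ r s : Idx F, z - x ^ r.val * (u : F) ^ s.val = 0 ↔ s = t - a * r := by
    intro r s
    have h1 : x ^ r.val * (u : F) ^ s.val = (u : F) ^ (discreteLog u x * r.val + s.val) := by
      rw [pow_add, pow_mul, generator_pow_discreteLog hu hx]
    rw [sub_eq_zero, h1]
    conv_lhs => rw [← generator_pow_discreteLog hu hz]
    rw [generator_pow_eq_iff hu]
    push_cast
    rw [ZMod.natCast_zmod_val, ZMod.natCast_zmod_val, eq_sub_iff_add_eq', eq_comm]
  have hsum : ∀ r : Idx F, ∑ s, qftEntry F l r * qftEntry F m s *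
      opV u (initialState v) (r, x, s, z) =
      ZMod.stdAddChar (m * t) / n ^ 2 * v x * ZMod.stdAddChar (r * (l - m * a)) := by
    intro r
    have h1 : ∀ s, qftEntry F l r * qftEntry F m s * opV u (initialState v) (r, x, s, z) =
        if s = t - a * r then ZMod.stdAddChar (l * r + m * s) / n * (v x / n) else 0 := by
      intro s
      rw [opV_initialState_apply, qftEntry_mul_qftEntry]
      simp only [initialState, hcond, mul_ite, mul_zero, ← hn]
    simp only [h1, sum_ite_eq', mem_univ, if_true]
    have h2 : l * r + m * (t - a * r) = m * t + r * (l - m * a) := by ring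
    rw [h2, AddChar.map_add_eq_mul]
    field_simp
  calc preMeasure u v (l, x, m, z) = ∑ r, ∑ s, qftEntry F l r * qftEntry F m s *
        opV u (initialState v) (r, x, s, z) := rfl
    _ = ZMod.stdAddChar (m * t) / n ^ 2 * v x *
        ∑ r : Idx F, ZMod.stdAddChar (r * (l - m * a)) := by
      rw [mul_sum]
      exact sum_congr rfl fun r _ => hsum r
    _ = _ := by
      -- Orthogonality: the sum over `r` is `q - 1` if `l = m a` and `0` otherwise.
      rw [AddChar.sum_mulShift _ (ZMod.isPrimitive_stdAddChar _), ZMod.card]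
      simp only [sub_eq_zero]
      split_ifs
      · rw [← hn]
        field_simp
      · simp

/-! ### Outcome probabilities and the collapsed state -/

theorem outcomeProb_zero {v : Ket F} (hv : v 0 = 0) (m : Idx F) : outcomeProb u v (m, 0) = 0 := by
  refine sum_eq_zero fun i _ => ?_
  change ‖preMeasure u v (i.1, i.2, m, 0)‖ ^ 2 = 0
  rw [preMeasure_apply_zero hv]
  simp

/-- Each `x` occurs with exactly one `l`, namely `m L(x)`, so the weight is `‖v‖² / (q-1)²`,
whatever `m` and `z` are. -/
theorem outcomeProb_of_ne_zero (hu : ∀ x : Fˣ, x ∈ Subgroup.zpowers u) {v : Ket F} (hv : v 0 = 0)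
    (hv1 : normSq v = 1) (m : Idx F) {z : F} (hz : z ≠ 0) :
    outcomeProb u v (m, z) = 1 / ((Fintype.card F - 1 : ℕ) : ℝ) ^ 2 := by
  classical
  have h : ∀ i : Idx F × F, ‖projected u v (m, z) i‖ ^ 2 =
      if i.1 = m * discreteLog u i.2 then
        1 / ((Fintype.card F - 1 : ℕ) : ℝ) ^ 2 * ‖v i.2‖ ^ 2 else 0 := by
    rintro ⟨l, x⟩
    change ‖preMeasure u v (l, x, m, z)‖ ^ 2 = _
    rw [preMeasure_apply hu hv l x m hz, norm_mul, norm_div, AddChar.norm_apply, Complex.norm_natCast,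
      mul_pow, div_pow, one_pow]
    split_ifs <;> simp
  rw [outcomeProb, normSq, sum_congr rfl fun i _ => h i, Fintype.sum_prod_type_right]
  simp only [sum_ite_eq', mem_univ, if_true]
  rw [← mul_sum]
  change _ * normSq v = _
  rw [hv1, mul_one]

theorem outcomeProb_nonneg (v : Ket F) (o : Idx F × F) : 0 ≤ outcomeProb u v o :=
  sum_nonneg fun _ _ => sq_nonneg _

theorem card_sub_one_pos (F : Type*) [Field F] [Fintype F] :
    (0 : ℝ) < ((Fintype.card F - 1 : ℕ) : ℝ) := by
  exact_mod_cast Nat.pos_of_neZero (Fintype.card F - 1)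

theorem sum_outcomeProb_snd (hu : ∀ x : Fˣ, x ∈ Subgroup.zpowers u) {v : Ket F} (hv : v 0 = 0)
    (hv1 : normSq v = 1) (m : Idx F) :
    ∑ z, outcomeProb u v (m, z) = 1 / ((Fintype.card F - 1 : ℕ) : ℝ) := by
  classical
  have hn := card_sub_one_pos F
  rw [← add_sum_erase _ _ (mem_univ (0 : F)), outcomeProb_zero hv, zero_add,
    sum_congr rfl fun z hz => outcomeProb_of_ne_zero hu hv hv1 m (ne_of_mem_erase hz), sum_const,
    card_erase_of_mem (mem_univ _), card_univ, nsmul_eq_mul]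
  field_simp

theorem sum_outcomeProb (hu : ∀ x : Fˣ, x ∈ Subgroup.zpowers u) {v : Ket F} (hv : v 0 = 0)
    (hv1 : normSq v = 1) : ∑ o, outcomeProb u v o = 1 := by
  have hn := card_sub_one_pos F
  rw [Fintype.sum_prod_type, sum_congr rfl fun m _ => sum_outcomeProb_snd hu hv hv1 m, sum_const,
    card_univ, ZMod.card, nsmul_eq_mul]
  field_simp

open Classical in
theorem collapsed_apply (hu : ∀ x : Fˣ, x ∈ Subgroup.zpowers u) {v : Ket F} (hv : v 0 = 0)
    (hv1 : normSq v = 1) (m : Idx F) {z : F} (hz : z ≠ 0) (l : Idx F) (x : F) :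
    collapsed u v (m, z) (l, x) = ZMod.stdAddChar (m * (discreteLog u z : Idx F)) *
      if l = m * discreteLog u x then v x else 0 := by
  have hn := card_sub_one_pos F
  have hn' : ((Fintype.card F - 1 : ℕ) : ℂ) ≠ 0 := by exact_mod_cast hn.ne'
  have h : projected u v (m, z) (l, x) = preMeasure u v (l, x, m, z) := rfl
  rw [collapsed, outcomeProb_of_ne_zero hu hv hv1 m hz, h, preMeasure_apply hu hv l x m hz,
    Real.sqrt_div zero_le_one, Real.sqrt_one, Real.sqrt_sq hn.le]
  push_cast
  field_simp

theorem opInv_apply {m : Idx F} (hm : Nat.Coprime m.val (Fintype.card F - 1))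
    (ψ : Ket (Idx F × F)) (j : Idx F) (x : F) : opInv m ψ (j, x) = ψ (m * j, x) := by
  have hunit : IsUnit m := by
    rw [← ZMod.natCast_zmod_val m]
    exact (ZMod.isUnit_iff_coprime _ _).2 hm
  have h1 : m * m⁻¹ = 1 := ZMod.mul_inv_of_unit m hunit
  refine basisMap_apply_of_unique ψ ?_
  rintro ⟨l, x'⟩
  simp only [Prod.mk.injEq]
  refine and_congr_left fun _ => ⟨?_, ?_⟩
  · rintro rfl
    rw [← mul_assoc, h1, one_mul]
  · rintro rfl
    rw [← mul_assoc, mul_comm m⁻¹, h1, one_mul]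

theorem opT_apply (hu : ∀ x : Fˣ, x ∈ Subgroup.zpowers u) (ψ : Ket (Idx F × F)) (y : Fˣ) (w : F) :
    opT u ψ (y, w) = ψ ((discreteLog u (y : F) : Idx F), y * w) := by
  refine basisMap_apply_of_unique ψ ?_
  rintro ⟨j, x⟩
  have h1 : u ^ j.val = y ↔ j = discreteLog u (y : F) := by
    rw [← generator_pow_val_eq_iff hu y.ne_zero, ← Units.val_inj, Units.val_pow_eq_pow_val]
  simp only [Prod.mk.injEq, h1]
  refine and_congr_right fun hj => ?_
  rw [h1.2 hj, Units.inv_mul_eq_iff_eq_mul]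

/-! ### Success of one run and of repeated runs -/

/-- Outcomes of positive probability with invertible third register lead to `T_k v`. -/
theorem runSucceeds_of_coprime (hu : ∀ x : Fˣ, x ∈ Subgroup.zpowers u) (k : ℤ) {v : Ket F}
    (hv : v 0 = 0) (hv1 : normSq v = 1) {m : Idx F}
    (hm : Nat.Coprime m.val (Fintype.card F - 1)) {z : F} (hz : z ≠ 0) :
    RunSucceeds u k v (m, z) := by
  classical
  refine ⟨_, if_pos hm, ZMod.stdAddChar (m * (discreteLog u z : Idx F)), AddChar.norm_apply _ _,
    fun y w => ?_⟩
  have hunit : IsUnit m := by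
    rw [← ZMod.natCast_zmod_val m]
    exact (ZMod.isUnit_iff_coprime _ _).2 hm
  rw [opT_apply hu, opU, opInv_apply hm, collapsed_apply hu hv hv1 m hz,
    ZMod.val_natCast_of_lt (discreteLog_lt hu y.ne_zero), Tk, if_neg y.ne_zero,
    mul_comm k]
  -- Cancelling `m` leaves the condition `L(y) = L(y w)`, which for `w ≠ 0` means `w = 1`. The case
  -- `w = 0` is separate, as the logarithm is injective only on nonzero elements; there `v 0 = 0` is
  -- used.
  simp only [hunit.mul_right_inj]
  rcases eq_or_ne w 1 with rfl | hw
  · simp only [mul_one, if_true]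
    ring
  · rw [if_neg hw]
    rcases eq_or_ne w 0 with rfl | hw0
    · simp [hv]
    · rw [if_neg]
      · simp
      · rw [discreteLog_cast_inj hu y.ne_zero (mul_ne_zero y.ne_zero hw0)]
        intro h
        exact hw (mul_left_cancel₀ y.ne_zero (by rw [← h, mul_one]))

theorem runSucceeds_of_outcomeProb_pos (hu : ∀ x : Fˣ, x ∈ Subgroup.zpowers u) (k : ℤ)
    {v : Ket F} (hv : v 0 = 0) (hv1 : normSq v = 1) {o : Idx F × F}
    (ho : 0 < outcomeProb u v o) (hm : Nat.Coprime o.1.val (Fintype.card F - 1)) :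
    RunSucceeds u k v o := by
  obtain ⟨m, z⟩ := o
  refine runSucceeds_of_coprime hu k hv hv1 hm ?_
  rintro rfl
  exact ho.ne' (outcomeProb_zero hv m)

theorem runSucceeds_coprime {k : ℤ} {v : Ket F} {o : Idx F × F} (h : RunSucceeds u k v o) :
    Nat.Coprime o.1.val (Fintype.card F - 1) := by
  obtain ⟨Ψ, hΨ, -⟩ := h
  by_contra hm
  simp [runOutput, hm] at hΨ

theorem card_filter_val_coprime (n : ℕ) [NeZero n] :
    #{m : ZMod n | Nat.Coprime m.val n} = n.totient := by
  rw [Nat.totient_eq_card_coprime]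
  refine card_nbij' ZMod.val (fun a => (a : ZMod n)) ?_ ?_ ?_ ?_
  · intro m hm
    simp only [coe_filter, mem_univ, true_and, Set.mem_ofPred_eq, mem_range] at hm ⊢
    exact ⟨ZMod.val_lt m, hm.symm⟩
  · intro a ha
    simp only [coe_filter, mem_univ, true_and, Set.mem_ofPred_eq, mem_range] at ha ⊢
    rw [ZMod.val_natCast_of_lt ha.1]
    exact ha.2.symm
  · intro m _
    exact ZMod.natCast_zmod_val m
  · intro a ha
    simp only [coe_filter, Set.mem_ofPred_eq, mem_range] at ha
    exact ZMod.val_natCast_of_lt ha.1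

theorem sum_outcomeProb_coprime (hu : ∀ x : Fˣ, x ∈ Subgroup.zpowers u) {v : Ket F}
    (hv : v 0 = 0) (hv1 : normSq v = 1) :
    ∑ o : Idx F × F,
      (if Nat.Coprime o.1.val (Fintype.card F - 1) then outcomeProb u v o else 0) =
      (Nat.totient (Fintype.card F - 1) : ℝ) / ((Fintype.card F - 1 : ℕ) : ℝ) := by
  rw [Fintype.sum_prod_type]
  have h : ∀ m : Idx F, ∑ z : F,
      (if Nat.Coprime m.val (Fintype.card F - 1) then outcomeProb u v (m, z) else 0) =
      if Nat.Coprime m.val (Fintype.card F - 1) then 1 / ((Fintype.card F - 1 : ℕ) : ℝ)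
      else 0 := by
    intro m
    split_ifs
    · exact sum_outcomeProb_snd hu hv hv1 m
    · simp
  rw [sum_congr rfl fun m _ => h m, ← sum_filter, sum_const, card_filter_val_coprime,
    nsmul_eq_mul, mul_one_div]

theorem runSuccessProb_eq (hu : ∀ x : Fˣ, x ∈ Subgroup.zpowers u) (k : ℤ) {v : Ket F}
    (hv : v 0 = 0) (hv1 : normSq v = 1) :
    runSuccessProb u k v =
      (Nat.totient (Fintype.card F - 1) : ℝ) / ((Fintype.card F - 1 : ℕ) : ℝ) := by
  rw [← sum_outcomeProb_coprime hu hv hv1]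
  refine sum_congr rfl fun o _ => ?_
  by_cases hm : Nat.Coprime o.1.val (Fintype.card F - 1)
  · rw [if_pos hm]
    rcases (outcomeProb_nonneg v o).eq_or_lt with h | h
    · rw [← h, ite_self]
    · rw [if_pos (runSucceeds_of_outcomeProb_pos hu k hv hv1 h hm)]
  · rw [if_neg hm, if_neg fun h => hm (runSucceeds_coprime h)]

/-- If every outcome of a run sequence has positive probability and some third register is
invertible, then the first run not reporting failure succeeds. -/
theorem repeatSucceeds_of_exists_coprime (hu : ∀ x : Fˣ, x ∈ Subgroup.zpowers u) (k : ℤ)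
    {v : Ket F} (hv : v 0 = 0) (hv1 : normSq v = 1) {N : ℕ} {ω : Fin N → Idx F × F}
    (hpos : ∀ i, 0 < outcomeProb u v (ω i))
    (hex : ∃ i, Nat.Coprime (ω i).1.val (Fintype.card F - 1)) : RepeatSucceeds u k v ω := by
  obtain ⟨i, hi, hmin⟩ := wellFounded_lt.has_min
    {i | Nat.Coprime (ω i).1.val (Fintype.card F - 1)} hex
  exact ⟨i, runSucceeds_of_outcomeProb_pos hu k hv hv1 (hpos i) hi,
    fun j hj => if_neg fun h => hmin j h hj⟩

/-- Term by term, the weight of a sequence of outcomes is at most its contribution to success plus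
its weight for failing in every run: an unsuccessful sequence of positive weight has no invertible
`m`. The failure weights `g` sum to `1 - φ(q-1)/(q-1)`, and their products to the `N`-th power. -/
theorem one_sub_pow_le_repeatSuccessProb (hu : ∀ x : Fˣ, x ∈ Subgroup.zpowers u) (k : ℤ)
    {v : Ket F} (hv : v 0 = 0) (hv1 : normSq v = 1) (N : ℕ) :
    1 - (1 - (Nat.totient (Fintype.card F - 1) : ℝ) / ((Fintype.card F - 1 : ℕ) : ℝ)) ^ N ≤
      repeatSuccessProb u k v N := by
  classical
  set g : Idx F × F → ℝ := fun o =>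
    if Nat.Coprime o.1.val (Fintype.card F - 1) then 0 else outcomeProb u v o with hg
  have hg0 : ∀ o, 0 ≤ g o := fun o => by
    simp only [hg]
    split_ifs
    exacts [le_rfl, outcomeProb_nonneg v o]
  have hgsum : ∑ o, g o =
      1 - (Nat.totient (Fintype.card F - 1) : ℝ) / ((Fintype.card F - 1 : ℕ) : ℝ) := by
    rw [← sum_outcomeProb_coprime hu hv hv1, ← sum_outcomeProb hu hv hv1, ← sum_sub_distrib]
    refine sum_congr rfl fun o _ => ?_
    simp only [hg]
    split_ifs <;> simp
  have h1 : ∑ ω : Fin N → Idx F × F, ∏ i, outcomeProb u v (ω i) = 1 := by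
    rw [← Fintype.sum_pow, sum_outcomeProb hu hv hv1, one_pow]
  have h2 : ∑ ω : Fin N → Idx F × F, ∏ i, g (ω i) =
      (1 - (Nat.totient (Fintype.card F - 1) : ℝ) / ((Fintype.card F - 1 : ℕ) : ℝ)) ^ N := by
    rw [← Fintype.sum_pow, hgsum]
  rw [← h2, ← h1, sub_le_iff_le_add, repeatSuccessProb, ← sum_add_distrib]
  refine sum_le_sum fun ω _ => ?_
  have hprod : 0 ≤ ∏ i, g (ω i) := prod_nonneg fun i _ => hg0 _
  split_ifs with hω
  · linarith
  · rw [zero_add]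
    by_cases hpos : ∀ i, 0 < outcomeProb u v (ω i)
    · refine (prod_congr rfl fun i _ => ?_).le
      simp only [hg]
      rw [if_neg fun h => hω (repeatSucceeds_of_exists_coprime hu k hv hv1 hpos ⟨i, h⟩)]
    · push Not at hpos
      obtain ⟨i, hi⟩ := hpos
      rw [prod_eq_zero (mem_univ i) (hi.antisymm (outcomeProb_nonneg v _))]
      exact hprod

/-- One has `(1 - p) ^ N ≤ exp (-p N)` and `p N ≥ 2 ℓ p (-log ε) ≥ -log ε`. -/
theorem one_sub_pow_le_of_log_le {p ℓ ε : ℝ} (hp1 : p ≤ 1) (hε0 : 0 < ε) (hε1 : ε < 1)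
    (hpℓ : 1 ≤ 2 * ℓ * p) (hp0 : 0 ≤ p) {N : ℕ} (hN : -2 * ℓ * Real.log ε ≤ N) :
    (1 - p) ^ N ≤ ε := by
  have hlog : Real.log ε < 0 := Real.log_neg hε0 hε1
  calc (1 - p) ^ N ≤ Real.exp (-p) ^ N :=
        pow_le_pow_left₀ (by linarith) (Real.one_sub_le_exp_neg p) N
    _ = Real.exp (N * -p) := (Real.exp_nat_mul _ _).symm
    _ ≤ Real.exp (Real.log ε) := by
      refine Real.exp_le_exp.2 ?_
      have h1 := mul_le_mul_of_nonneg_right hN hp0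
      have h2 := mul_le_mul_of_nonneg_right hpℓ (neg_nonneg.2 hlog.le)
      nlinarith
    _ = ε := Real.exp_log hε0

end TkAlgorithm

theorem lemma6 :
    (∀ (F : Type w) [Field F] [Fintype F] (u : Fˣ), (∀ x : Fˣ, x ∈ Subgroup.zpowers u) →
      ∀ (k : ℤ) (v : F → ℂ), v 0 = 0 → TkAlgorithm.normSq v = 1 →
        (∑ o, TkAlgorithm.outcomeProb u v o = 1) ∧
        (∀ o, 0 < TkAlgorithm.outcomeProb u v o →
          Nat.Coprime o.1.val (Fintype.card F - 1) → TkAlgorithm.RunSucceeds u k v o) ∧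
        TkAlgorithm.runSuccessProb u k v =
          (Nat.totient (Fintype.card F - 1) : ℝ) / ((Fintype.card F - 1 : ℕ) : ℝ)) ∧
    ∃ Q₀ : ℕ, ∀ (F : Type w) [Field F] [Fintype F], Q₀ ≤ Fintype.card F →
      ∀ u : Fˣ, (∀ x : Fˣ, x ∈ Subgroup.zpowers u) →
      ∀ (k : ℤ) (v : F → ℂ), v 0 = 0 → TkAlgorithm.normSq v = 1 →
      ∀ ε : ℝ, 0 < ε → ε < 1 →
      ∀ N : ℕ, -2 * Real.log (Real.log ((Fintype.card F : ℝ) - 1)) * Real.log ε ≤ (N : ℝ) →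
        1 - ε ≤ TkAlgorithm.repeatSuccessProb u k v N := by
  refine ⟨fun F _ _ u hu k v hv hv1 => ⟨TkAlgorithm.sum_outcomeProb hu hv hv1,
    fun o ho hm => TkAlgorithm.runSucceeds_of_outcomeProb_pos hu k hv hv1 ho hm,
    TkAlgorithm.runSuccessProb_eq hu k hv hv1⟩, ?_⟩
  obtain ⟨n₀, hn₀⟩ :=
    Filter.eventually_atTop.1 Mertens.eventually_one_le_totient_div_mul_log_log
  -- The totient bound is applied to `q - 1`, hence the shift by one.
  refine ⟨n₀ + 1, fun F _ _ hQ u hu k v hv hv1 ε hε0 hε1 N hN => ?_⟩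
  have hcast : ((Fintype.card F - 1 : ℕ) : ℝ) = (Fintype.card F : ℝ) - 1 := by
    rw [Nat.cast_sub Fintype.one_lt_card.le, Nat.cast_one]
  rw [← hcast] at hN
  have hle : ((Fintype.card F - 1).totient : ℝ) / ((Fintype.card F - 1 : ℕ) : ℝ) ≤ 1 :=
    div_le_one_of_le₀ (by exact_mod_cast Nat.totient_le _) (Nat.cast_nonneg _)
  have hpow := TkAlgorithm.one_sub_pow_le_of_log_le hle hε0 hε1
    (hn₀ (Fintype.card F - 1) (by lia)) (by positivity) hN
  have hrep := TkAlgorithm.one_sub_pow_le_repeatSuccessProb hu k hv hv1 N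
  linarith
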